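/- Let $A$ be a unital C*-algebra and let $l_2(A)$ be the standard (left) Hilbert $A$-module of all sequences $(a_i)_{i\in\mathbb N}$ in $A$ for which $\sum_i a_i a_i^*$ converges in norm, with $A$-valued inner product $\langle a,b\rangle=\sum_i a_i b_i^*$. Let $J$ be a countable index set. For a Hilbert $A$-module $\mathcal H$, a family $\{x_j\}_{j\in J}\subset\mathcal H$ is a standard normalized tight frame of $\mathcal H$ if $\sum_j\langle x,x_j\rangle\langle x_j,x\rangle$ converges in norm to $\langle x,x\rangle$ for every $x\in\mathcal H$; it is an orthonormal basis of $\mathcal H$ if $\langle x_i,x_j\rangle=\delta_{ij}1_A$ for all $i,j$ and its $A$-linear span is norm-dense in $\mathcal H$. Standard normalized tight frames $\{x_{1j}\}_j,\dots,\{x_{nj}\}_j$ of $l_2(A)$ are called strongly complementary if their inner sum $\{x_{1j}\oplus\dots\oplus x_{nj}\}_{j\in J}$ is a standard normalized tight frame and an orthonormal basis of the orthogonal direct sum $l_2(A)\oplus\dots\oplus l_2(A)$ ($n$ summands). Let $\{x_{1j}\}_{j},\dots,\{x_{nj}\}_{j}$ be standard normalized tight frames of $l_2(A)$ and let $\{e_j\}_{j\in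 J}$ be an orthonormal basis of $l_2(A)$. Then the formula $$T_k(x)=\sum_{j}\langle x,x_{kj}\rangle e_j\qquad(x\in l_2(A),\ k=1,\dots,n)$$ (norm convergence) defines bounded adjointable $A$-linear partial isometries $T_1,\dots,T_n$ on $l_2(A)$, and the following conditions are equivalent: 1. the operators $T_1,\dots,T_n$ have pairwise orthogonal ranges and $\sum_k T_kT_k^*=\mathrm{id}_{l_2(A)}$; 2. the sequence $\{\sum_{k=1}^n T_k(x_{kj})\}_{j}$ is an orthonormal basis of $l_2(A)$; 3. the frames $\{x_{1j}\}_j,\dots,\{x_{nj}\}_j$ are strongly complementary. -/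

import Mathlib

open scoped ComplexOrder WithCStarModule

noncomputable section HilbertModules

/-! Mathlib's `A`-valued inner product `inner A x y` on a left Hilbert `A`-module is `A`-linear in
its second slot. The definitions below are written with the opposite convention
`⟨x, y⟩ = aip A x y`, which is `A`-linear in the first slot and conjugate-linear in the second. -/

/-- The `A`-valued inner product `⟨x, y⟩`, `A`-linear in `x`. -/
abbrev aip (A : Type*) {E : Type*} [Inner A E] (x y : E) : A := inner A y x

section Frames

variable (A : Type*) [CStarAlgebra A] [PartialOrder A]
variable {E : Type*} [NormedAddCommGroup E] [Module ℂ E] [Module A E] [CStarModule A E]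
variable {J : Type*}

/-- A standard normalized tight frame of a Hilbert `A`-module: for every `v`, the sum
`∑ j, ⟨v, x j⟩ ⟨x j, v⟩` converges in norm, and its value is `⟨v, v⟩`
(both frame bounds are equal to one). -/
def IsStandardNormalizedTightFrame (x : J → E) : Prop :=
  ∀ v : E, HasSum (fun j => aip A v (x j) * aip A (x j) v) (aip A v v)

/-- An orthonormal basis of a Hilbert `A`-module over a unital C⋆-algebra: pairwise orthogonal
elements with `⟨e j, e j⟩ = 1` whose `A`-linear span is norm-dense. -/
structure IsOrthonormalBasis (e : J → E) : Prop where
  inner_self_eq_one : ∀ j, aip A (e j) (e j) = 1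
  orthogonal : Pairwise fun i j => aip A (e i) (e j) = 0
  dense_span : Dense (Submodule.span A (Set.range e) : Set E)

variable {F : Type*} [NormedAddCommGroup F] [Module ℂ F] [Module A F] [CStarModule A F]

/-- `S : F → E` is the adjoint of `T : E → F`. It is unique if it exists. -/
def IsAdjointOf (S : F → E) (T : E → F) : Prop :=
  ∀ v w, aip A (T v) w = aip A v (S w)

variable {ι : Type*} [Fintype ι] {H : ι → Type*} [∀ k, NormedAddCommGroup (H k)]
  [∀ k, Module ℂ (H k)] [∀ k, Module A (H k)] [∀ k, CStarModule A (H k)]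

/-- The inner sum `{ ⊕ₖ x k j }_j` of finitely many sequences, a sequence in the orthogonal direct
sum of the Hilbert `A`-modules `H k`, whose inner product is `⟨v, w⟩ = ∑ k, ⟨v k, w k⟩`. -/
def innerSum (x : ∀ k, J → H k) : J → C⋆ᵐᵒᵈ(A, Π k, H k) :=
  fun j => (WithCStarModule.equiv A (Π k, H k)).symm fun k => x k j

/-- A tuple of standard normalized tight frames is strongly complementary if the inner sum is a
standard normalized tight frame and an orthonormal basis of the direct sum of the modules. -/
structure StronglyComplementary [StarOrderedRing A] (x : ∀ k, J → H k) : Prop where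
  summand_frame : ∀ k, IsStandardNormalizedTightFrame A (x k)
  innerSum_frame : IsStandardNormalizedTightFrame A (innerSum A x)
  innerSum_basis : IsOrthonormalBasis A (innerSum A x)

end Frames

theorem summable_of_nonneg_of_le_cstar {A : Type*} [CStarAlgebra A] [PartialOrder A]
    [StarOrderedRing A] {f g : ℕ → A} (hf : ∀ j, 0 ≤ f j) (hfg : ∀ j, f j ≤ g j)
    (hg : Summable g) : Summable f := by
  rw [summable_iff_vanishing_norm] at hg ⊢
  intro ε hε
  obtain ⟨s, hs⟩ := hg ε hε
  refine ⟨s, fun t ht => lt_of_le_of_lt ?_ (hs t ht)⟩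
  exact CStarAlgebra.norm_le_norm_of_nonneg_of_le (Finset.sum_nonneg fun j _ => hf j)
    (Finset.sum_le_sum fun j _ => hfg j)

/-- The left `A`-module of all sequences `a` for which `∑ j, a j * (a j)⋆` converges in norm. -/
def l2Submodule (A : Type*) [CStarAlgebra A] [PartialOrder A] [StarOrderedRing A] :
    Submodule A (ℕ → A) where
  carrier := {a | Summable fun j => a j * star (a j)}
  zero_mem' := by simp
  add_mem' := by
    intro a b ha hb
    refine summable_of_nonneg_of_le_cstar (fun j => mul_star_self_nonneg _) (fun j => ?_)
      ((ha.add hb).add (ha.add hb))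
    have h := mul_star_self_nonneg (a j - b j)
    rw [← sub_nonneg]
    convert h using 1
    simp only [Pi.add_apply, star_add, star_sub]
    noncomm_ring
  smul_mem' := by
    intro c a ha
    refine ((Summable.mul_left c ha).mul_right (star c)).congr fun j => ?_
    simp [mul_assoc]

/-- The standard Hilbert `A`-module `l₂(A)`. It carries the norm of its `A`-valued inner product,
not the topology of pointwise convergence. -/
def StdHilbertModule (A : Type*) [CStarAlgebra A] [PartialOrder A] [StarOrderedRing A] : Type _ :=
  l2Submodule A

namespace StdHilbertModule

variable {A : Type*} [CStarAlgebra A] [PartialOrder A] [StarOrderedRing A]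

instance : AddCommGroup (StdHilbertModule A) := inferInstanceAs (AddCommGroup (l2Submodule A))

instance : Module A (StdHilbertModule A) := inferInstanceAs (Module A (l2Submodule A))

instance : Module ℂ (StdHilbertModule A) := inferInstanceAs (Module ℂ (l2Submodule A))

instance : IsScalarTower ℂ A (StdHilbertModule A) :=
  inferInstanceAs (IsScalarTower ℂ A (l2Submodule A))

/-- Entries of a sequence in `l₂(A)`. -/
instance : FunLike (StdHilbertModule A) ℕ A where
  coe a := Subtype.val (p := (· ∈ l2Submodule A)) a
  coe_injective _ _ h := Subtype.ext h

@[ext] theorem ext {a b : StdHilbertModule A} (h : ∀ j, a j = b j) : a = b :=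
  DFunLike.ext a b h

@[simp] theorem zero_apply (j : ℕ) : (0 : StdHilbertModule A) j = 0 := rfl

@[simp] theorem add_apply (a b : StdHilbertModule A) (j : ℕ) : (a + b) j = a j + b j := rfl

@[simp] theorem smul_apply (c : A) (a : StdHilbertModule A) (j : ℕ) : (c • a) j = c * a j := rfl

@[simp] theorem complex_smul_apply (c : ℂ) (a : StdHilbertModule A) (j : ℕ) :
    (c • a) j = c • a j := rfl

theorem summable_self (a : StdHilbertModule A) : Summable fun j => a j * star (a j) := a.2

theorem summable_mul_star (a b : StdHilbertModule A) : Summable fun j => b j * star (a j) := by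
  have h₁ := ((a + b).summable_self.sub a.summable_self).sub b.summable_self
  have h₂ := ((a + Complex.I • b).summable_self.sub a.summable_self).sub b.summable_self
  refine ((h₁.sub (h₂.const_smul Complex.I)).const_smul (2⁻¹ : ℂ)).congr fun j => ?_
  have hI : ∀ z : A, Complex.I • Complex.I • z = -z := fun z => by
    rw [smul_smul, Complex.I_mul_I, neg_one_smul]
  have e₁ : (a + b) j * star ((a + b) j) - a j * star (a j) - b j * star (b j)
      = a j * star (b j) + b j * star (a j) := by
    simp only [add_apply, star_add]; noncomm_ring
  have e₂ : (a + Complex.I • b) j * star ((a + Complex.I • b) j) - a j * star (a j)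
      - b j * star (b j) = Complex.I • (b j * star (a j)) - Complex.I • (a j * star (b j)) := by
    simp only [add_apply, complex_smul_apply, star_add, star_smul, add_mul, mul_add,
      smul_add, smul_mul_assoc, mul_smul_comm, Complex.star_def, Complex.conj_I, neg_smul, mul_neg, hI]
    abel
  rw [e₁, e₂, smul_sub Complex.I, hI, hI]
  module

instance : Norm (StdHilbertModule A) := ⟨fun a => √‖∑' j, a j * star (a j)‖⟩

/-- The `A`-valued inner product of `l₂(A)` is `⟨a, b⟩ = ∑ j, a j * (b j)⋆`, with the slots
exchanged according to Mathlib's convention. -/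
instance : CStarModule A (StdHilbertModule A) where
  inner a b := ∑' j, b j * star (a j)
  inner_add_right {a b c} := by
    rw [← (summable_mul_star a b).tsum_add (summable_mul_star a c)]
    simp only [add_apply, add_mul]
  inner_self_nonneg {a} := tsum_nonneg fun j => mul_star_self_nonneg _
  inner_self {a} := by
    refine ⟨fun h => ?_, fun h => by simp [h]⟩
    have h₀ := (hasSum_zero_iff_of_nonneg fun j => mul_star_self_nonneg (a j)).1
      (h ▸ a.summable_self.hasSum)
    ext j
    simpa using congrFun h₀ j
  inner_op_smul_right {c a b} := by
    rw [← (summable_mul_star a b).tsum_mul_left]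
    simp only [smul_apply, mul_assoc]
  inner_smul_right_complex {z a b} := by
    rw [← (summable_mul_star a b).tsum_const_smul]
    simp only [complex_smul_apply, smul_mul_assoc]
  star_inner a b := by
    rw [tsum_star]
    simp only [star_mul, star_star]
  norm_eq_sqrt_norm_inner_self a := rfl

theorem aip_def (a b : StdHilbertModule A) : aip A a b = ∑' j, a j * star (b j) := rfl

instance : NormedAddCommGroup (StdHilbertModule A) := CStarModule.normedAddCommGroup A

instance : NormedSpace ℂ (StdHilbertModule A) := .ofCore (CStarModule.normedSpaceCore A)

end StdHilbertModule

end HilbertModules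

/-! Polarizing the frame identity gives `⟨T_k v, T_k w⟩ = ⟨v, w⟩`, so each `T_k` is an isometry. Its
adjoint `S_k` is the synthesis operator, with `S_k e_j = x_kj` and `S_k T_k = id`. Adjoints do not
come for free in Hilbert modules: `S_k` is built from a series, which converges because `l₂(A)` is
complete.

All three conditions say that `P = ∑ T_k S_k` is the identity. The sequence in condition 2 is `P
e_j`, and a positive operator taking an orthonormal basis to an orthonormal system is the identity
(`IsOrthonormalBasis.eq_id_of_positive`). In condition 3 the inner sum has Gram matrix `⟨P e_i,
e_j⟩` (`stronglyComplementary_iff`). In condition 1 orthogonality of the ranges already follows from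
`P = id` (`pairwise_orthogonal_of_sum_comp_adjoint_eq_id`). -/

namespace StdHilbertModule

/-! ### Completeness of `l₂(A)` -/

variable {A : Type*} [CStarAlgebra A] [PartialOrder A] [StarOrderedRing A]

@[simp] theorem sub_apply (a b : StdHilbertModule A) (j : ℕ) : (a - b) j = a j - b j := rfl

/-- The sequence that agrees with `b` on the finite set `s` and vanishes elsewhere. -/
def truncate (s : Finset ℕ) (b : ℕ → A) : StdHilbertModule A :=
  ⟨fun j => if j ∈ s then b j else 0, summable_of_ne_finset_zero (s := s) fun j hj => by simp [hj]⟩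

theorem truncate_apply (s : Finset ℕ) (b : ℕ → A) (j : ℕ) :
    truncate s b j = if j ∈ s then b j else 0 := rfl

theorem truncate_sub (s : Finset ℕ) (b c : ℕ → A) :
    truncate s (b - c) = truncate s b - truncate s c := by
  ext j
  by_cases hj : j ∈ s <;> simp [truncate_apply, hj]

theorem norm_def (a : StdHilbertModule A) : ‖a‖ = √‖∑' j, a j * star (a j)‖ := rfl

theorem norm_truncate (s : Finset ℕ) (b : ℕ → A) :
    ‖truncate s b‖ = √‖∑ j ∈ s, b j * star (b j)‖ := by
  rw [norm_def, tsum_eq_sum (s := s) fun j hj => by simp [truncate_apply, hj]]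
  congr 2
  exact Finset.sum_congr rfl fun j hj => by simp [truncate_apply, hj]

theorem continuous_norm_truncate (s : Finset ℕ) :
    Continuous fun b : ℕ → A => ‖truncate s b‖ := by
  simp only [norm_truncate]
  fun_prop

theorem norm_truncate_le (s : Finset ℕ) (a : StdHilbertModule A) : ‖truncate s a‖ ≤ ‖a‖ := by
  rw [norm_truncate, norm_def]
  gcongr
  exact CStarAlgebra.norm_le_norm_of_nonneg_of_le
    (Finset.sum_nonneg fun j _ => mul_star_self_nonneg _)
    (a.summable_self.sum_le_tsum s fun j _ => mul_star_self_nonneg _)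

theorem norm_le_of_norm_truncate_le {a : StdHilbertModule A} {C : ℝ}
    (h : ∀ s, ‖truncate s a‖ ≤ C) : ‖a‖ ≤ C := by
  refine le_of_tendsto (x := Filter.atTop) ?_ (Filter.Eventually.of_forall h)
  simp only [norm_truncate]
  exact (Real.continuous_sqrt.tendsto _).comp (a.summable_self.hasSum.norm)

/-- The Cauchy criterion in terms of norms of truncations, to which the triangle inequality applies.
-/
theorem mem_l2Submodule_iff {b : ℕ → A} :
    b ∈ l2Submodule A ↔ ∀ ε > 0, ∃ s : Finset ℕ, ∀ t, Disjoint t s → ‖truncate t b‖ < ε := by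
  change Summable _ ↔ _
  simp only [norm_truncate, summable_iff_vanishing_norm]
  constructor
  · intro h ε hε
    obtain ⟨s, hs⟩ := h (ε ^ 2) (by positivity)
    exact ⟨s, fun t ht => (Real.sqrt_lt' hε).2 (hs t ht)⟩
  · intro h ε hε
    obtain ⟨s, hs⟩ := h (√ε) (by positivity)
    exact ⟨s, fun t ht => (Real.sqrt_lt_sqrt_iff (norm_nonneg _)).1 (hs t ht)⟩

theorem norm_apply_le (a : StdHilbertModule A) (j : ℕ) : ‖a j‖ ≤ ‖a‖ := by
  have h := norm_truncate_le {j} a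
  rwa [norm_truncate, Finset.sum_singleton, CStarRing.norm_self_mul_star,
    Real.sqrt_mul_self (norm_nonneg _)] at h

instance : CompleteSpace (StdHilbertModule A) := by
  refine Metric.complete_of_cauchySeq_tendsto fun u hu => ?_
  have hcoord : ∀ j, ∃ y, Filter.Tendsto (fun m => u m j) Filter.atTop (nhds y) := fun j => by
    refine cauchySeq_tendsto_of_complete (Metric.cauchySeq_iff.2 fun ε hε => ?_)
    obtain ⟨N, hN⟩ := Metric.cauchySeq_iff.1 hu ε hε
    refine ⟨N, fun m hm k hk => lt_of_le_of_lt ?_ (hN m hm k hk)⟩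
    rw [dist_eq_norm, dist_eq_norm]
    exact norm_apply_le (u m - u k) j
  choose b hb using hcoord
  -- For fixed `s` the truncated norm is continuous for pointwise convergence, so the Cauchy
  -- estimate survives the limit, uniformly in `s`. This bound gives both membership of `b` in
  -- `l₂(A)` and convergence in norm.
  have hbound : ∀ ε > 0, ∃ N, ∀ m ≥ N, ∀ s, ‖truncate s (b - ⇑(u m))‖ ≤ ε := fun ε hε => by
    obtain ⟨N, hN⟩ := Metric.cauchySeq_iff.1 hu ε hε
    refine ⟨N, fun m hm s => ?_⟩
    have hlim : Filter.Tendsto (fun k => ‖truncate s (⇑(u k) - ⇑(u m))‖) Filter.atTop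
        (nhds ‖truncate s (b - ⇑(u m))‖) :=
      ((continuous_norm_truncate s).tendsto _).comp
        (tendsto_pi_nhds.2 fun j => (hb j).sub_const _)
    refine le_of_tendsto hlim (Filter.eventually_atTop.2 ⟨N, fun k hk => ?_⟩)
    refine (norm_truncate_le s (u k - u m)).trans ?_
    rw [← dist_eq_norm]
    exact (hN k hk m hm).le
  have hmem : b ∈ l2Submodule A := mem_l2Submodule_iff.2 fun ε hε => by
    obtain ⟨N, hN⟩ := hbound (ε / 2) (by positivity)
    obtain ⟨s, hs⟩ := mem_l2Submodule_iff.1 (u N).2 (ε / 2) (by positivity)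
    refine ⟨s, fun t ht => ?_⟩
    have hsplit : truncate t b = truncate t (b - ⇑(u N)) + truncate t (u N) := by
      rw [truncate_sub, sub_add_cancel]
    rw [hsplit]
    have h₁ := hN N le_rfl t
    have h₂ : ‖truncate t (u N)‖ < ε / 2 := hs t ht
    linarith [norm_add_le (truncate t (b - ⇑(u N))) (truncate t (u N))]
  let a : StdHilbertModule A := ⟨b, hmem⟩
  refine ⟨a, Metric.tendsto_atTop.2 fun ε hε => ?_⟩
  obtain ⟨N, hN⟩ := hbound (ε / 2) (by positivity)
  refine ⟨N, fun m hm => ?_⟩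
  rw [dist_comm, dist_eq_norm]
  have h : ‖a - u m‖ ≤ ε / 2 := norm_le_of_norm_truncate_le (hN m hm)
  linarith

end StdHilbertModule

/-! ### Polarization, Bessel's identity and Fourier expansion -/

section Sums

/-- Kept abstract because it is applied both to the inner product and to each term of the frame
series. -/
theorem polarization_identity {E A : Type*} [AddCommGroup E] [Module ℂ E] [AddCommGroup A]
    [Module ℂ A] {b : E → E → A}
    (hadd_left : ∀ v v' w, b (v + v') w = b v w + b v' w)
    (hadd_right : ∀ v w w', b v (w + w') = b v w + b v w')
    (hsmul_left : ∀ (z : ℂ) v w, b (z • v) w = z • b v w)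
    (hsmul_right : ∀ (z : ℂ) v w, b v (z • w) = star z • b v w) (v w : E) :
    b v w = (4⁻¹ : ℂ) • ((b (v + w) (v + w) - b (v + (-1 : ℂ) • w) (v + (-1 : ℂ) • w)) +
      Complex.I • (b (v + Complex.I • w) (v + Complex.I • w) -
        b (v + (-Complex.I) • w) (v + (-Complex.I) • w))) := by
  have hI : ∀ z : A, Complex.I • Complex.I • z = -z := fun z => by
    rw [smul_smul, Complex.I_mul_I, neg_one_smul]
  simp only [hadd_left, hadd_right, hsmul_left, hsmul_right]
  simp only [Complex.star_def, Complex.conj_I, map_neg, map_one, neg_smul, one_smul, smul_add, smul_sub, smul_neg, neg_neg, hI]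
  module

variable {A : Type*} [CStarAlgebra A] [PartialOrder A]
variable {E : Type*} [NormedAddCommGroup E] [NormedSpace ℂ E] [Module A E] [CStarModule A E]
variable {J : Type*}

theorem eq_of_forall_aip_eq {v w : E} (h : ∀ u, aip A v u = aip A w u) : v = w := by
  rw [← sub_eq_zero, ← CStarModule.inner_self (A := A), CStarModule.inner_sub_right, sub_eq_zero]
  exact h _

/-- On the algebraic span the Fourier expansion is finite; enlarging the index set only adds zero
terms. -/
theorem sum_aip_smul_of_mem_span {e : J → E} {u : E}
    (h₁ : ∀ j, aip A (e j) (e j) = 1)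
    (h₀ : Pairwise fun i j => aip A (e i) (e j) = 0) (hu : u ∈ Submodule.span A (Set.range e)) :
    ∃ s : Finset J, ∀ t ⊇ s, ∑ j ∈ t, aip A u (e j) • e j = u := by
  classical
  induction hu using Submodule.span_induction with
  | mem y hy =>
    obtain ⟨i, rfl⟩ := hy
    refine ⟨{i}, fun t ht => ?_⟩
    rw [Finset.sum_eq_single_of_mem i (ht (Finset.mem_singleton_self i)), h₁, one_smul]
    intro j _ hj
    rw [h₀ hj.symm, zero_smul]
  | zero => exact ⟨∅, fun t _ => by simp⟩
  | add y z _ _ hy hz =>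
    obtain ⟨s, hs⟩ := hy
    obtain ⟨s', hs'⟩ := hz
    refine ⟨s ∪ s', fun t ht => ?_⟩
    simp only [aip, CStarModule.inner_add_right, add_smul, Finset.sum_add_distrib]
    exact congrArg₂ (· + ·) (hs t (Finset.union_subset_left ht))
      (hs' t (Finset.union_subset_right ht))
  | smul a y _ hy =>
    obtain ⟨s, hs⟩ := hy
    refine ⟨s, fun t ht => ?_⟩
    simp only [aip, CStarModule.inner_op_smul_right, mul_smul, ← Finset.smul_sum]
    exact congrArg (a • ·) (hs t ht)

theorem eq_of_forall_aip_eq' {v w : E} (h : ∀ u, aip A u v = aip A u w) : v = w :=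
  eq_of_forall_aip_eq (A := A) fun u => by
    simpa only [aip, CStarModule.star_inner] using congrArg star (h u)

/-- Polarization of the defining identity of a standard normalized tight frame. -/
theorem IsStandardNormalizedTightFrame.hasSum_aip {x : J → E}
    (hx : IsStandardNormalizedTightFrame A x) (v w : E) :
    HasSum (fun j => aip A v (x j) * aip A (x j) w) (aip A v w) := by
  have h := (((hx (v + w)).sub (hx (v + (-1 : ℂ) • w))).add
    (((hx (v + Complex.I • w)).sub (hx (v + (-Complex.I) • w))).const_smul Complex.I)).const_smul
      (4⁻¹ : ℂ)
  rw [← polarization_identity (b := fun v w => aip A v w)] at h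
  · refine h.congr_fun fun j => ?_
    refine polarization_identity (b := fun v w => aip A v (x j) * aip A (x j) w) ?_ ?_ ?_ ?_ v w
    all_goals intros; simp [add_mul, mul_add]
  all_goals intros; simp

variable {e : J → E}

theorem aip_sum_smul_sum_smul (h₁ : ∀ j, aip A (e j) (e j) = 1)
    (h₀ : Pairwise fun i j => aip A (e i) (e j) = 0) (s : Finset J) (c d : J → A) :
    aip A (∑ j ∈ s, c j • e j) (∑ j ∈ s, d j • e j) = ∑ j ∈ s, c j * star (d j) := by
  simp only [aip, CStarModule.inner_sum_left, CStarModule.inner_sum_right,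
    CStarModule.inner_op_smul_left, CStarModule.inner_op_smul_right]
  refine Finset.sum_congr rfl fun i hi => ?_
  rw [Finset.sum_eq_single_of_mem i hi]
  · rw [show inner A (e i) (e i) = (1 : A) from h₁ i, one_mul]
  · intro j _ hj
    rw [show inner A (e j) (e i) = (0 : A) from h₀ hj.symm, zero_mul]

/-- Bessel's identity for a finite part of an orthonormal family. -/
theorem aip_sub_sum_self (h₁ : ∀ j, aip A (e j) (e j) = 1)
    (h₀ : Pairwise fun i j => aip A (e i) (e j) = 0) (s : Finset J) (v : E) :
    aip A (v - ∑ j ∈ s, aip A v (e j) • e j) (v - ∑ j ∈ s, aip A v (e j) • e j) =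
      aip A v v - ∑ j ∈ s, aip A v (e j) * aip A (e j) v := by
  have h := aip_sum_smul_sum_smul h₁ h₀ s (fun j => aip A v (e j)) (fun j => aip A v (e j))
  simp only [aip, CStarModule.star_inner] at h
  simp only [aip, CStarModule.inner_sub_left, CStarModule.inner_sub_right, h]
  simp only [CStarModule.inner_sum_left, CStarModule.inner_sum_right,
    CStarModule.inner_op_smul_left, CStarModule.inner_op_smul_right, CStarModule.star_inner]
  abel

theorem IsOrthonormalBasis.norm_sum_smul (he : IsOrthonormalBasis A e) (s : Finset J) (c : J → A) :
    ‖∑ j ∈ s, c j • e j‖ = √‖∑ j ∈ s, c j * star (c j)‖ := by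
  rw [CStarModule.norm_eq_sqrt_norm_inner_self (A := A)]
  congr 2
  exact aip_sum_smul_sum_smul he.inner_self_eq_one he.orthogonal s c c

/-- An orthonormal family that is a standard normalized tight frame is an orthonormal basis. -/
theorem IsStandardNormalizedTightFrame.isOrthonormalBasis
    (hx : IsStandardNormalizedTightFrame A e) (h₁ : ∀ j, aip A (e j) (e j) = 1)
    (h₀ : Pairwise fun i j => aip A (e i) (e j) = 0) : IsOrthonormalBasis A e where
  inner_self_eq_one := h₁
  orthogonal := h₀
  dense_span v := by
    have h : Filter.Tendsto (fun s : Finset J => ∑ j ∈ s, aip A v (e j) • e j) Filter.atTop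
        (nhds v) := by
      rw [tendsto_iff_norm_sub_tendsto_zero]
      -- By Bessel's identity, the squared norm of the remainder is the norm of `⟨v, v⟩` minus a
      -- partial sum of the frame series.
      have h' := (Real.continuous_sqrt.tendsto _).comp ((hx v).const_sub (aip A v v)).norm
      simp only [sub_self, norm_zero, Real.sqrt_zero] at h'
      refine h'.congr fun s => ?_
      rw [norm_sub_rev, CStarModule.norm_eq_sqrt_norm_inner_self (A := A)]
      exact congrArg (fun z : A => √‖z‖) (aip_sub_sum_self h₁ h₀ s v).symm
    exact mem_closure_of_tendsto h (Filter.Eventually.of_forall fun s =>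
      Submodule.sum_mem _ fun j _ => Submodule.smul_mem _ _ (Submodule.subset_span ⟨j, rfl⟩))

theorem norm_eq_norm_of_aip_eq {F : Type*} [NormedAddCommGroup F] [Module ℂ F] [Module A F]
    [CStarModule A F] {v : E} {w : F} (h : aip A v v = aip A w w) : ‖v‖ = ‖w‖ := by
  rw [CStarModule.norm_eq_sqrt_norm_inner_self (A := A) v,
    CStarModule.norm_eq_sqrt_norm_inner_self (A := A) w]
  exact congrArg (fun z : A => √‖z‖) h

variable [StarOrderedRing A]

theorem HasSum.aip_left {f : J → E} {a : E} (h : HasSum f a) (w : E) :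
    HasSum (fun j => aip A (f j) w) (aip A a w) :=
  (CStarModule.innerSL (A := A) w).hasSum h

theorem HasSum.aip_right {f : J → E} {a : E} (h : HasSum f a) (w : E) :
    HasSum (fun j => aip A w (f j)) (aip A w a) := by
  simpa only [aip, CStarModule.star_inner] using (h.aip_left (A := A) w).star

theorem norm_le_norm_of_aip_le {F : Type*} [NormedAddCommGroup F] [Module ℂ F] [Module A F]
    [CStarModule A F] {v : E} {w : F} (h : aip A v v ≤ aip A w w) : ‖v‖ ≤ ‖w‖ := by
  rw [CStarModule.norm_eq_sqrt_norm_inner_self (A := A) v,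
    CStarModule.norm_eq_sqrt_norm_inner_self (A := A) w]
  gcongr
  exact CStarAlgebra.norm_le_norm_of_nonneg_of_le CStarModule.inner_self_nonneg h

/-- Fourier expansion with respect to an orthonormal basis. -/
theorem IsOrthonormalBasis.hasSum_aip_smul (he : IsOrthonormalBasis A e) (v : E) :
    HasSum (fun j => aip A v (e j) • e j) v := by
  rw [HasSum, SummationFilter.unconditional_filter, Metric.tendsto_nhds]
  intro ε hε
  obtain ⟨u, hu, hvu⟩ := Metric.mem_closure_iff.1 (he.dense_span v) ε hε
  obtain ⟨s, hs⟩ := sum_aip_smul_of_mem_span he.inner_self_eq_one he.orthogonal hu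
  refine (Filter.eventually_ge_atTop s).mono fun t ht => lt_of_le_of_lt ?_ hvu
  -- Since `u` equals its own partial sum over `t`, the remainders of `v` and `v - u` agree; Bessel
  -- bounds the latter by `‖v - u‖`.
  have hsub : v - ∑ j ∈ t, aip A v (e j) • e j =
      (v - u) - ∑ j ∈ t, aip A (v - u) (e j) • e j := by
    simp only [aip, CStarModule.inner_sub_right, sub_smul, Finset.sum_sub_distrib]
    rw [hs t ht]
    abel
  rw [dist_comm, dist_eq_norm, dist_eq_norm, hsub]
  refine norm_le_norm_of_aip_le (A := A) ?_
  rw [aip_sub_sum_self he.inner_self_eq_one he.orthogonal, sub_le_self_iff]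
  refine Finset.sum_nonneg fun j _ => ?_
  rw [aip, aip, ← CStarModule.star_inner (v - u) (e j)]
  exact star_mul_self_nonneg _

/-- Parseval's identity. -/
theorem IsOrthonormalBasis.isStandardNormalizedTightFrame (he : IsOrthonormalBasis A e) :
    IsStandardNormalizedTightFrame A e := fun v => by
  simpa only [aip, CStarModule.inner_op_smul_right] using
    (he.hasSum_aip_smul v).aip_left (A := A) v

end Sums

/-! ### Analysis operators and their adjoints -/

section AnalysisOperator

variable {A : Type*} [CStarAlgebra A] [PartialOrder A]
variable {E : Type*} [NormedAddCommGroup E] [NormedSpace ℂ E] [Module A E] [CStarModule A E]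
variable {F : Type*} [NormedAddCommGroup F] [NormedSpace ℂ F] [Module A F] [CStarModule A F]
variable {J : Type*} {x : J → E} {e : J → F}

theorem IsOrthonormalBasis.summable_smul_iff [CompleteSpace F] (he : IsOrthonormalBasis A e)
    {c : J → A} : (Summable fun j => c j • e j) ↔ Summable fun j => c j * star (c j) := by
  simp only [summable_iff_vanishing_norm, he.norm_sum_smul]
  constructor
  · intro h ε hε
    obtain ⟨s, hs⟩ := h (√ε) (by positivity)
    exact ⟨s, fun t ht => (Real.sqrt_lt_sqrt_iff (norm_nonneg _)).1 (hs t ht)⟩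
  · intro h ε hε
    obtain ⟨s, hs⟩ := h (ε ^ 2) (by positivity)
    exact ⟨s, fun t ht => (Real.sqrt_lt' hε).2 (hs t ht)⟩

variable [StarOrderedRing A]

/-- The analysis operator of a standard normalized tight frame with respect to an orthonormal
basis. -/
theorem exists_analysisOperator [CompleteSpace F] (hx : IsStandardNormalizedTightFrame A x)
    (he : IsOrthonormalBasis A e) :
    ∃ T : E →L[A] F, ∀ v, HasSum (fun j => aip A v (x j) • e j) (T v) := by
  have hsum : ∀ v, Summable fun j => aip A v (x j) • e j := fun v =>
    he.summable_smul_iff.2 <| (hx v).summable.congr fun j => by rw [aip, CStarModule.star_inner]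
  have hT : ∀ v, HasSum (fun j => aip A v (x j) • e j) (∑' j, aip A v (x j) • e j) :=
    fun v => (hsum v).hasSum
  let T : E →ₗ[A] F :=
    { toFun := fun v => ∑' j, aip A v (x j) • e j
      map_add' := fun v w => by
        rw [← (hsum v).tsum_add (hsum w)]
        simp only [aip, CStarModule.inner_add_right, add_smul]
      map_smul' := fun a v => by
        -- Paired with `u`, the scalar `a` acts by left multiplication in `A`, which commutes with
        -- the sum.
        refine eq_of_forall_aip_eq (A := A) fun u => ?_
        refine ((hT (a • v)).aip_left u).unique ?_
        have h := ((hT v).aip_left (A := A) u).mul_left a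
        simpa only [aip, CStarModule.inner_op_smul_right, RingHom.id_apply, mul_assoc] using h }
  have hle : ∀ v, ‖T v‖ ≤ ‖v‖ := fun v => by
    refine le_of_tendsto (hT v).norm (Filter.Eventually.of_forall fun s => ?_)
    rw [he.norm_sum_smul, CStarModule.norm_eq_sqrt_norm_inner_self (A := A) v]
    gcongr
    refine CStarAlgebra.norm_le_norm_of_nonneg_of_le
      (Finset.sum_nonneg fun j _ => mul_star_self_nonneg _) ?_
    simp only [aip, CStarModule.star_inner]
    refine sum_le_hasSum s (fun j _ => ?_) (hx v)
    rw [← CStarModule.star_inner v (x j)]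
    exact star_mul_self_nonneg _
  exact ⟨⟨T, AddMonoidHomClass.continuous_of_bound T 1 fun v => by simpa using hle v⟩, hT⟩

variable {T : E →L[A] F}

theorem aip_analysisOperator_basis (he : IsOrthonormalBasis A e)
    (hT : ∀ v, HasSum (fun j => aip A v (x j) • e j) (T v)) (v : E) (j : J) :
    aip A (T v) (e j) = aip A v (x j) := by
  classical
  refine ((hT v).aip_left (e j)).unique ?_
  convert hasSum_single j fun i hi => ?_ using 1
  · simp [show inner A (e j) (e j) = (1 : A) from he.inner_self_eq_one j]
  · simp [show inner A (e j) (e i) = (0 : A) from he.orthogonal hi]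

/-- Parseval for `e` and the polarized frame identity for `x` sum the same terms. -/
theorem aip_analysisOperator (hx : IsStandardNormalizedTightFrame A x)
    (he : IsOrthonormalBasis A e)
    (hT : ∀ v, HasSum (fun j => aip A v (x j) • e j) (T v)) (v w : E) :
    aip A (T v) (T w) = aip A v w := by
  refine (he.isStandardNormalizedTightFrame.hasSum_aip (T v) (T w)).unique ?_
  refine (hx.hasSum_aip v w).congr_fun fun j => ?_
  have h := congrArg star (aip_analysisOperator_basis he hT w j)
  simp only [aip, CStarModule.star_inner] at h
  exact congrArg₂ (· * ·) (aip_analysisOperator_basis he hT v j) h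

/-- The adjoint of an isometry is a contraction, by Cauchy–Schwarz at `u = v`. Stated for a single
pair of vectors, it applies before the adjoint is known to exist. -/
theorem norm_le_of_aip_eq {v : E} {w : F} (hiso : ∀ u, ‖T u‖ = ‖u‖)
    (h : ∀ u, aip A (T u) w = aip A u v) : ‖v‖ ≤ ‖w‖ := by
  rcases eq_or_ne ‖v‖ 0 with h₀ | h₀
  · simp [h₀]
  refine le_of_mul_le_mul_right ?_ (lt_of_le_of_ne (norm_nonneg v) h₀.symm)
  calc ‖v‖ * ‖v‖ = ‖aip A (T v) w‖ := by rw [h, ← sq, CStarModule.norm_sq_eq A]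
    _ ≤ ‖w‖ * ‖T v‖ := CStarModule.norm_inner_le F
    _ = ‖w‖ * ‖v‖ := by rw [hiso]

/-- The synthesis operator of a standard normalized tight frame is the adjoint of its analysis
operator. -/
theorem exists_isAdjointOf_analysisOperator [CompleteSpace E] [CompleteSpace F]
    (hx : IsStandardNormalizedTightFrame A x) (he : IsOrthonormalBasis A e)
    (hT : ∀ v, HasSum (fun j => aip A v (x j) • e j) (T v)) :
    ∃ S : F →L[A] E, IsAdjointOf A S T := by
  have hiso : ∀ v, ‖T v‖ = ‖v‖ := fun v =>
    norm_eq_norm_of_aip_eq (aip_analysisOperator hx he hT v v)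
  -- Finite synthesis sums are dominated by the sums over `e`, so the Cauchy criterion passes from
  -- the Fourier series of `w` to its synthesis series.
  have hfin : ∀ (c : J → A) (s : Finset J), ‖∑ j ∈ s, c j • x j‖ ≤ ‖∑ j ∈ s, c j • e j‖ :=
    fun c s => norm_le_of_aip_eq hiso fun u => by
      simp only [aip, CStarModule.inner_sum_left, CStarModule.inner_op_smul_left]
      exact Finset.sum_congr rfl fun j _ =>
        congrArg (· * star (c j)) (aip_analysisOperator_basis he hT u j)
  have hsum : ∀ w, Summable fun j => aip A w (e j) • x j := fun w => by
    have h := (he.hasSum_aip_smul w).summable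
    rw [summable_iff_vanishing_norm] at h ⊢
    intro ε hε
    obtain ⟨s, hs⟩ := h ε hε
    exact ⟨s, fun t ht => (hfin _ t).trans_lt (hs t ht)⟩
  have hadj : ∀ v w, aip A (T v) w = aip A v (∑' j, aip A w (e j) • x j) := fun v w => by
    refine ((he.hasSum_aip_smul w).aip_right (T v)).unique ?_
    refine ((hsum w).hasSum.aip_right (A := A) v).congr_fun fun j => ?_
    simp only [aip, CStarModule.inner_op_smul_left]
    exact congrArg (· * star _) (aip_analysisOperator_basis he hT v j)
  let S : F →ₗ[A] E :=
    { toFun := fun w => ∑' j, aip A w (e j) • x j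
      map_add' := fun w w' => eq_of_forall_aip_eq' (A := A) fun u => by
        rw [← hadj]
        simp only [aip, CStarModule.inner_add_left]
        exact congrArg₂ (· + ·) (hadj u w) (hadj u w')
      map_smul' := fun a w => eq_of_forall_aip_eq' (A := A) fun u => by
        rw [← hadj]
        simp only [aip, CStarModule.inner_op_smul_left, RingHom.id_apply]
        exact congrArg (· * star a) (hadj u w) }
  exact ⟨⟨S, AddMonoidHomClass.continuous_of_bound S 1 fun w => by
    rw [one_mul]
    exact norm_le_of_aip_eq hiso fun u => hadj u w⟩, hadj⟩

end AnalysisOperator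

/-! ### The operator `∑ T_k S_k` and the three conditions -/

section PartialIsometries

variable {A : Type*} [CStarAlgebra A] [PartialOrder A]
variable {E : Type*} [NormedAddCommGroup E] [NormedSpace ℂ E] [Module A E] [CStarModule A E]
variable {F : Type*} [NormedAddCommGroup F] [NormedSpace ℂ F] [Module A F] [CStarModule A F]
variable {J : Type*} {e : J → F}

theorem IsAdjointOf.leftInverse {T : E → F} {S : F → E} (h : IsAdjointOf A S T)
    (hiso : ∀ v w, aip A (T v) (T w) = aip A v w) (v : E) : S (T v) = v :=
  eq_of_forall_aip_eq' (A := A) fun u => by rw [← h, hiso]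

theorem IsOrthonormalBasis.ext_clm (he : IsOrthonormalBasis A e) {P Q : F →L[A] F}
    (h : ∀ j, P (e j) = Q (e j)) : P = Q :=
  ContinuousLinearMap.ext_on he.dense_span (by rintro _ ⟨j, rfl⟩; exact h j)

variable {ι : Type*} [Fintype ι] {T : ι → E →L[A] F} {S : ι → F →L[A] E}

/-- Yields self-adjointness and positivity of `∑ T_k S_k`, and identifies it with the Gram matrix of
the inner sum. -/
theorem aip_sum_comp_adjoint (hS : ∀ k, IsAdjointOf A (S k) (T k)) (v w : F) :
    aip A ((∑ k, T k ∘L S k) v) w = ∑ k, aip A (S k v) (S k w) := by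
  rw [_root_.sum_apply, aip, CStarModule.inner_sum_right]
  exact Finset.sum_congr rfl fun k _ => hS k _ _

variable [StarOrderedRing A]

theorem IsOrthonormalBasis.ext_aip (he : IsOrthonormalBasis A e) {v w : F}
    (h : ∀ j, aip A v (e j) = aip A w (e j)) : v = w := by
  refine (he.hasSum_aip_smul v).unique ?_
  simpa only [h] using he.hasSum_aip_smul w

/-- A positive operator that maps an orthonormal basis onto an orthonormal system is the
identity. -/
theorem IsOrthonormalBasis.eq_id_of_positive (he : IsOrthonormalBasis A e) {P : F →L[A] F}
    (hP : IsAdjointOf A P P) (hpos : ∀ v, 0 ≤ aip A (P v) v)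
    (h₁ : ∀ j, aip A (P (e j)) (P (e j)) = 1)
    (h₀ : Pairwise fun i j => aip A (P (e i)) (P (e j)) = 0) :
    P = ContinuousLinearMap.id A F := by
  have hsq : P ∘L P = ContinuousLinearMap.id A F := he.ext_clm fun i => he.ext_aip fun j => by
    rw [ContinuousLinearMap.comp_apply, hP, ContinuousLinearMap.id_apply]
    rcases eq_or_ne i j with rfl | hij
    · rw [h₁, he.inner_self_eq_one]
    · rw [h₀ hij, he.orthogonal hij]
  ext v
  -- As `P² = id`, the vector `v - P v` is in the `-1` eigenspace, which positivity forces to be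
  -- zero.
  have hq : P (v - P v) = -(v - P v) := by
    rw [map_sub, show P (P v) = v from DFunLike.congr_fun hsq v, neg_sub]
  have h := hpos (v - P v)
  rw [hq, aip, CStarModule.inner_neg_right, neg_nonneg] at h
  have h' := CStarModule.inner_self.1 (le_antisymm h CStarModule.inner_self_nonneg)
  exact (sub_eq_zero.1 h').symm

/-- Isometries whose range projections add up to the identity have orthogonal ranges. -/
theorem pairwise_orthogonal_of_sum_comp_adjoint_eq_id
    (hS : ∀ k, IsAdjointOf A (S k) (T k)) (hiso : ∀ k v w, aip A (T k v) (T k w) = aip A v w)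
    (hsum : ∑ k, T k ∘L S k = ContinuousLinearMap.id A F) :
    Pairwise fun k l => ∀ v w, aip A (T k v) (T l w) = 0 := by
  classical
  intro k l hkl v w
  -- The `l`-th term already equals the total `⟨w, w⟩`, so the other positive terms vanish and `S_k
  -- T_l w = 0`.
  have h := aip_sum_comp_adjoint hS (T l w) (T l w)
  rw [hsum, ContinuousLinearMap.id_apply, hiso, ← Finset.add_sum_erase _ _ (Finset.mem_univ l),
    (hS l).leftInverse (hiso l), left_eq_add,
    Finset.sum_eq_zero_iff_of_nonneg fun _ _ => CStarModule.inner_self_nonneg] at h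
  have h' := CStarModule.inner_self.1 (h k (Finset.mem_erase.2 ⟨hkl, Finset.mem_univ k⟩))
  rw [hS, h', aip, CStarModule.inner_zero_left]

theorem isOrthonormalBasis_sum_comp_adjoint_iff (he : IsOrthonormalBasis A e)
    (hS : ∀ k, IsAdjointOf A (S k) (T k)) :
    (IsOrthonormalBasis A fun j => (∑ k, T k ∘L S k) (e j)) ↔
      ∑ k, T k ∘L S k = ContinuousLinearMap.id A F := by
  refine ⟨fun h => he.eq_id_of_positive (fun v w => ?_) (fun v => ?_) h.inner_self_eq_one
    h.orthogonal, fun h => by simpa only [h, ContinuousLinearMap.id_apply] using he⟩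
  · have h' := congrArg star (aip_sum_comp_adjoint hS w v)
    simp only [star_sum, aip, CStarModule.star_inner] at h'
    exact (aip_sum_comp_adjoint hS v w).trans h'.symm
  · rw [aip_sum_comp_adjoint hS]
    exact Finset.sum_nonneg fun k _ => CStarModule.inner_self_nonneg

/-- The map `v ↦ ∑ T_k v_k` embeds the direct sum isometrically and turns coefficients against the
inner sum into coefficients against `e`; Parseval for `e` pulls back. -/
theorem innerSum_isStandardNormalizedTightFrame {x : ι → J → E} (he : IsOrthonormalBasis A e)
    (hTx : ∀ k v j, aip A (T k v) (e j) = aip A v (x k j))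
    (hiso : ∀ k v w, aip A (T k v) (T k w) = aip A v w)
    (horth : Pairwise fun k l => ∀ v w, aip A (T k v) (T l w) = 0) :
    IsStandardNormalizedTightFrame A (innerSum A x) := fun v => by
  have h₁ : ∀ j, aip A (∑ k, T k (v k)) (e j) = aip A v (innerSum A x j) := fun j => by
    rw [aip, CStarModule.inner_sum_right]
    exact Finset.sum_congr rfl fun k _ => hTx k _ _
  have h₂ : aip A (∑ k, T k (v k)) (∑ k, T k (v k)) = aip A v v := by
    rw [aip, CStarModule.inner_sum_right]
    refine Finset.sum_congr rfl fun k _ => ?_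
    rw [CStarModule.inner_sum_left, Finset.sum_eq_single_of_mem k (Finset.mem_univ k)]
    · exact hiso k _ _
    · exact fun l _ hl => horth hl.symm _ _
  have h₃ : ∀ j, aip A (e j) (∑ k, T k (v k)) = aip A (innerSum A x j) v := fun j => by
    simpa only [aip, CStarModule.star_inner] using congrArg star (h₁ j)
  simpa only [h₁, h₂, h₃] using he.isStandardNormalizedTightFrame (∑ k, T k (v k))

theorem stronglyComplementary_iff {x : ι → J → E}
    (hx : ∀ k, IsStandardNormalizedTightFrame A (x k)) (he : IsOrthonormalBasis A e)
    (hS : ∀ k, IsAdjointOf A (S k) (T k)) (hSe : ∀ k j, S k (e j) = x k j)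
    (hiso : ∀ k v w, aip A (T k v) (T k w) = aip A v w) :
    StronglyComplementary A x ↔ ∑ k, T k ∘L S k = ContinuousLinearMap.id A F := by
  have hX : ∀ i j, aip A (innerSum A x i) (innerSum A x j) =
      aip A ((∑ k, T k ∘L S k) (e i)) (e j) := fun i j => by
    rw [aip_sum_comp_adjoint hS]
    simp only [hSe]
    rfl
  constructor
  · refine fun h => he.ext_clm fun i => he.ext_aip fun j => ?_
    rw [← hX, ContinuousLinearMap.id_apply]
    rcases eq_or_ne i j with rfl | hij
    · rw [h.innerSum_basis.inner_self_eq_one, he.inner_self_eq_one]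
    · rw [h.innerSum_basis.orthogonal hij, he.orthogonal hij]
  · intro h
    simp only [h, ContinuousLinearMap.id_apply] at hX
    -- The Gram matrix gives only orthonormality; density of the span comes from the frame property.
    have hframe : IsStandardNormalizedTightFrame A (innerSum A x) :=
      innerSum_isStandardNormalizedTightFrame he (fun k v j => by rw [hS, hSe]) hiso
        (pairwise_orthogonal_of_sum_comp_adjoint_eq_id hS hiso h)
    exact ⟨hx, hframe, hframe.isOrthonormalBasis (fun j => by rw [hX, he.inner_self_eq_one])
      fun i j hij => (hX i j).trans (he.orthogonal hij)⟩

end PartialIsometries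

theorem mainTheorem10 {A : Type*} [CStarAlgebra A] [PartialOrder A] [StarOrderedRing A]
    {J : Type*} [Countable J] (n : ℕ)
    (x : Fin n → J → StdHilbertModule A)
    (hx : ∀ k, IsStandardNormalizedTightFrame A (x k))
    (e : J → StdHilbertModule A) (he : IsOrthonormalBasis A e) :
    ∃ T Tadj : Fin n → (StdHilbertModule A →L[A] StdHilbertModule A),
      (∀ k v, HasSum (fun j => aip A v (x k j) • e j) (T k v)) ∧
      (∀ k, IsAdjointOf A (Tadj k) (T k)) ∧
      (∀ k, T k ∘L Tadj k ∘L T k = T k) ∧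
      (((Pairwise fun k l => ∀ v w, aip A (T k v) (T l w) = 0) ∧
          ∑ k, T k ∘L Tadj k = ContinuousLinearMap.id A (StdHilbertModule A)) ↔
        IsOrthonormalBasis A fun j => ∑ k, T k (x k j)) ∧
      (((Pairwise fun k l => ∀ v w, aip A (T k v) (T l w) = 0) ∧
          ∑ k, T k ∘L Tadj k = ContinuousLinearMap.id A (StdHilbertModule A)) ↔
        StronglyComplementary A x) := by
  choose T hT using fun k => exists_analysisOperator (hx k) he
  choose S hS using fun k => exists_isAdjointOf_analysisOperator (hx k) he (hT k)
  have hiso : ∀ k v w, aip A (T k v) (T k w) = aip A v w := fun k =>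
    aip_analysisOperator (hx k) he (hT k)
  have hSe : ∀ k j, S k (e j) = x k j := fun k j =>
    eq_of_forall_aip_eq' (A := A) fun u => by
      rw [← hS, aip_analysisOperator_basis he (hT k)]
  have hiff : ((Pairwise fun k l => ∀ v w, aip A (T k v) (T l w) = 0) ∧
      ∑ k, T k ∘L S k = ContinuousLinearMap.id A (StdHilbertModule A)) ↔
      ∑ k, T k ∘L S k = ContinuousLinearMap.id A (StdHilbertModule A) :=
    ⟨And.right, fun h => ⟨pairwise_orthogonal_of_sum_comp_adjoint_eq_id hS hiso h, h⟩⟩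
  refine ⟨T, S, hT, hS, fun k => ?_, ?_, ?_⟩
  · ext1 v
    exact congrArg (T k) ((hS k).leftInverse (hiso k) v)
  · rw [hiff, ← isOrthonormalBasis_sum_comp_adjoint_iff he hS]
    simp only [_root_.sum_apply, ContinuousLinearMap.comp_apply, hSe]
  · rw [hiff, stronglyComplementary_iff hx he hS hSe hiso]
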